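/- **Proposition.** Let $k\ge 1$ be an integer, $p\in[0,1)$ and $b\in[1,\infty)$. Then there exist $\hat p\in[p,1)$, an infinite, locally finite tree $\mathbb T=(V,E)$ with branching number $b$, and a $k$-independent site percolation $Z=(Z_v)_{v\in V}$ on $\mathbb T$ with parameter $\hat p$ such that, for $q\in[0,1]$, $Z$ stochastically dominates the Bernoulli product field with parameter $q$ on $\{0,1\}^V$ (all sites independent and open with probability $q$) if and only if $q=0$. Here the branching number of a tree rooted at $o$ is the supremum of all $\lambda\ge 1$ for which there is a nonzero function $f:V\to[0,\infty)$ such that, for every $v\in V$, $f(v)=\sum_{w} f(w)\le\lambda^{-d(o,v)}$, where the sum runs over the children $w$ of $v$; it does not depend on the choice of the root $o$. A site percolation with parameter $\hat p$ is a random element $Z$ of $\{0,1\}^V$ with $\mathbb P(Z_v=1)=\hat p$ for all $v\in V$. It is $k$-independent if $(Z_v)_{v\in U}$ and $(Z_v)_{v\in W}$ are independent for all $U,W\subseteq V$ at graph distance $d(U,W)>k$. A random element $X$ of $\{0,1\}^V$ stochastically dominates $Y$ if there is a coupling of $X$ and $Y$ under which $X\ge Y$ coordinatewise almost surely. -/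

import Mathlib

open MeasureTheory ProbabilityTheory

namespace TreePercolation

/-- The children of the vertex `v` in the tree `G` rooted at `o`: the neighbours of `v` that lie one
level further away from the root. -/
def children {V : Type*} (G : SimpleGraph V) (o v : V) : Set V :=
  {w | G.Adj v w ∧ G.dist o w = G.dist o v + 1}

/-- A `lam`-flow on the tree `G` rooted at `o`: the nonnegative value at each vertex `v` is the sum
of the values at its children and is at most `lam ^ (-|v|)`, where `|v|` is the level of `v`. -/
def IsFlow {V : Type*} (G : SimpleGraph V) (o : V) (lam : ℝ) (f : V → ℝ) : Prop :=
  ∀ v, 0 ≤ f v ∧ HasSum (fun w : children G o v => f w) (f v) ∧ f v ≤ (lam ^ G.dist o v)⁻¹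

/-- `b` is the branching number of the tree `G` rooted at `o`, that is, the supremum of all
`lam ≥ 1` for which there is a nonzero `lam`-flow. -/
def IsBranchingNumber {V : Type*} (G : SimpleGraph V) (o : V) (b : ℝ) : Prop :=
  IsLUB {lam : ℝ | 1 ≤ lam ∧ ∃ f : V → ℝ, f ≠ 0 ∧ IsFlow G o lam f} b

/-- `Z` is a site percolation on the vertex set `V` (`true` means open) in which every single site
is open with probability `p`. -/
def IsSitePercolation {V Ω : Type*} [MeasurableSpace Ω] (P : Measure Ω) (Z : Ω → V → Bool)
    (p : ℝ) : Prop :=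
  Measurable Z ∧ ∀ v, P {ω | Z ω v = true} = ENNReal.ofReal p

/-- `k`-independence: the restrictions of `Z` to any two sets of vertices of graph distance greater
than `k` are independent. -/
def IsKIndependent {V Ω : Type*} [MeasurableSpace Ω] (G : SimpleGraph V) (k : ℕ) (P : Measure Ω)
    (Z : Ω → V → Bool) : Prop :=
  ∀ U W : Set V, (∀ u ∈ U, ∀ w ∈ W, k < G.dist u w) →
    IndepFun (fun ω (u : U) => Z ω u) (fun ω (w : W) => Z ω w) P

/-- The law `μ` on `{0,1}^V` stochastically dominates the law `ν`: there is a coupling of the two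
under which the first configuration is almost surely coordinatewise at least the second. -/
def StochDominates {V : Type*} (μ ν : Measure (V → Bool)) : Prop :=
  ∃ π : Measure ((V → Bool) × (V → Bool)),
    π.map Prod.fst = μ ∧ π.map Prod.snd = ν ∧ ∀ᵐ x ∂π, x.2 ≤ x.1

/-- The Bernoulli product field: all sites are independent and open with probability `q`. -/
noncomputable def bernoulliField (V : Type*) (q : unitInterval) : Measure (V → Bool) :=
  Measure.infinitePi fun _ : V => bernoulliMeasure true false q

end TreePercolation

/-! Fix a vertex `c` with a finite set `S` of neighbours. Let all sites other than `c` be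
independent and open with probability `x`, and declare `c` open exactly when some site of `S` is
closed. If `x + x ^ |S| = 1`, then `c` too is open with probability `x`. Since `c` depends only on
its neighbours, the field is `k`-independent for every `k ≥ 1`. But `c` and `S` are never all open
together, whereas the product field with `q > 0` opens them all with positive probability, so
domination fails (`not_stochDominates_starField`).

A large `|S|` permits a large `x < 1`, so a tree is needed with branching number `b` and a root of
large degree. In a spherically symmetric tree with level sizes between `b ^ n` and `C * (n + 1) * b
^ n`, the evenly splitting flow gives the lower bound on the branching number and sphere counting
the upper bound (`isBranchingNumber_symTree`). The degree of the root only affects `C`. -/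

namespace TreePercolation

/-! ### Flows on rooted trees -/

section Flow

variable {V : Type*} {G : SimpleGraph V} {o : V} {lam : ℝ} {f : V → ℝ}

/-- In a rooted tree every vertex is the child of at most one vertex. -/
lemma eq_of_mem_children (hG : G.IsTree) {x y w : V} (hx : w ∈ children G o x)
    (hy : w ∈ children G o y) : x = y := by
  obtain ⟨p, hp⟩ := hG.connected.exists_walk_length_eq_dist o x
  obtain ⟨q, hq⟩ := hG.connected.exists_walk_length_eq_dist o y
  have hp' : (p.concat hx.1).IsPath :=
    SimpleGraph.Walk.isPath_of_length_eq_dist _ (by rw [SimpleGraph.Walk.length_concat, hp, hx.2])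
  have hq' : (q.concat hy.1).IsPath :=
    SimpleGraph.Walk.isPath_of_length_eq_dist _ (by rw [SimpleGraph.Walk.length_concat, hq, hy.2])
  -- Both geodesics extend to paths from `o` to `w`; these coincide in a tree, hence so do their
  -- penultimate vertices.
  have h := congrArg (fun r => r.1.penultimate)
    ((hG.isAcyclic.subsingleton_path o w).elim ⟨_, hp'⟩ ⟨_, hq'⟩)
  simpa using h

/-- In a connected rooted graph every vertex other than the root is a child. -/
lemma exists_mem_children (hG : G.Connected) {w : V} {n : ℕ} (hw : G.dist o w = n + 1) :
    ∃ v, G.dist o v = n ∧ w ∈ children G o v := by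
  obtain ⟨p, hp⟩ := hG.exists_walk_length_eq_dist w o
  rw [SimpleGraph.dist_comm, hw] at hp
  cases p with
  | nil => simp at hp
  | @cons _ v _ h q =>
    have h1 : G.dist o v ≤ n := by
      rw [SimpleGraph.dist_comm]
      refine (SimpleGraph.dist_le q).trans ?_
      simpa using hp.le
    have h2 := hG.dist_triangle (u := o) (v := v) (w := w)
    have h3 := SimpleGraph.dist_eq_one_iff_adj.2 h.symm
    have h4 : G.dist o v = n := by omega
    exact ⟨v, h4, h.symm, by omega⟩

lemma IsFlow.le_of_mem_children (hf : IsFlow G o lam f) {v w : V} (hw : w ∈ children G o v) :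
    f w ≤ f v :=
  le_hasSum (hf v).2.1 ⟨w, hw⟩ fun j _ => (hf j).1

lemma IsFlow.le_root (hG : G.Connected) (hf : IsFlow G o lam f) (v : V) : f v ≤ f o := by
  induction h : G.dist o v generalizing v with
  | zero => rw [hG.dist_eq_zero_iff.1 h]
  | succ n ih =>
    obtain ⟨u, hu, hv⟩ := exists_mem_children hG h
    exact (hf.le_of_mem_children hv).trans (ih u hu)

/-- The flow out of the root is carried by each finite sphere. -/
lemma IsFlow.root_le_sum_sphere (hG : G.IsTree) (hf : IsFlow G o lam f)
    (hfin : ∀ n, {v | G.dist o v = n}.Finite) (n : ℕ) :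
    f o ≤ ∑ v ∈ (hfin n).toFinset, f v := by
  classical
  induction n with
  | zero =>
    refine Finset.single_le_sum (f := f) (fun v _ => (hf v).1) ?_
    simp
  | succ n ih =>
    refine ih.trans ?_
    have hch : ∀ v, (children G o v).Finite := fun v =>
      (hfin (G.dist o v + 1)).subset fun w hw => hw.2
    have hsum : ∀ v, f v = ∑ w ∈ (hch v).toFinset, f w := by
      intro v
      have h1 := (hf v).2.1
      have h2 : HasSum (fun w : ((hch v).toFinset : Set V) => f w) (∑ w ∈ (hch v).toFinset, f w) :=
        Finset.hasSum _ f
      rw [Set.Finite.coe_toFinset] at h2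
      exact h1.unique h2
    calc ∑ v ∈ (hfin n).toFinset, f v
        = ∑ v ∈ (hfin n).toFinset, ∑ w ∈ (hch v).toFinset, f w :=
          Finset.sum_congr rfl fun v _ => hsum v
      _ = ∑ w ∈ (hfin n).toFinset.biUnion fun v => (hch v).toFinset, f w := by
          rw [Finset.sum_biUnion]
          intro x _ y _ hxy
          refine Finset.disjoint_left.2 fun w hx hy => hxy ?_
          exact eq_of_mem_children hG ((hch x).mem_toFinset.1 hx) ((hch y).mem_toFinset.1 hy)
      _ ≤ ∑ w ∈ (hfin (n + 1)).toFinset, f w := by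
          refine Finset.sum_le_sum_of_subset_of_nonneg ?_ fun v _ _ => (hf v).1
          intro w hw
          simp only [Finset.mem_biUnion, Set.Finite.mem_toFinset, Set.mem_ofPred_eq] at hw ⊢
          obtain ⟨v, hv, hw⟩ := hw
          rw [hw.2, hv]

lemma IsFlow.root_le_card_sphere (hG : G.IsTree) (hf : IsFlow G o lam f)
    (hfin : ∀ n, {v | G.dist o v = n}.Finite) (n : ℕ) :
    f o ≤ (hfin n).toFinset.card * (lam ^ n)⁻¹ := by
  refine (hf.root_le_sum_sphere hG hfin n).trans ?_
  rw [← nsmul_eq_mul]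
  refine Finset.sum_le_card_nsmul _ _ _ fun v hv => ?_
  have hv' : G.dist o v = n := (hfin n).mem_toFinset.1 hv
  simpa [hv'] using (hf v).2.2

end Flow

/-! ### The percolation with one dependent site -/

section Star

variable {V : Type*}

open Classical in
/-- The configuration that agrees with `ω` off the site `c`, and in which `c` is open exactly when
some site of `S` is closed in `ω`. -/
noncomputable def starField (c : V) (S : Finset V) (ω : V → Bool) (v : V) : Bool :=
  if v = c then decide (∃ s ∈ S, ω s = false) else ω v

lemma starField_center {c : V} {S : Finset V} {ω : V → Bool} :
    starField c S ω c = true ↔ ∃ s ∈ S, ω s = false := by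
  simp [starField]

lemma starField_of_ne {c v : V} {S : Finset V} {ω : V → Bool} (h : v ≠ c) :
    starField c S ω v = ω v := by
  simp [starField, h]

/-- The sites of the underlying independent field on which the value of `starField` at `v` depends. -/
def starSupport (c : V) (S : Finset V) (v : V) : Set V := {u | (v = c ∧ u ∈ S) ∨ (v ≠ c ∧ u = v)}

/-- The σ-algebra is arbitrary so that it can later be the one generated by the sites of a support.
-/
lemma measurable_starField_apply (c : V) (S : Finset V) (v : V) (m : MeasurableSpace (V → Bool))
    (hm : ∀ u ∈ starSupport c S v, Measurable[m] fun ω : V → Bool => ω u) :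
    Measurable[m] fun ω => starField c S ω v := by
  by_cases h : v = c
  · subst h
    refine measurable_to_bool ?_
    have : (fun ω => starField v S ω v) ⁻¹' {true} =
        ⋃ s ∈ S, (fun ω : V → Bool => ω s) ⁻¹' {false} := by
      ext ω
      simp [starField_center]
    rw [this]
    exact Finset.measurableSet_biUnion _ fun s hs =>
      hm s (Or.inl ⟨rfl, hs⟩) (measurableSet_singleton _)
  · simp only [starField_of_ne h]
    exact hm v (Or.inr ⟨h, rfl⟩)

lemma measurable_starField (c : V) (S : Finset V) : Measurable (starField c S) :=
  measurable_pi_iff.2 fun v => measurable_starField_apply c S v _ fun u _ => measurable_pi_apply u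

instance (q : unitInterval) : IsProbabilityMeasure (bernoulliField V q) := by
  unfold bernoulliField; infer_instance

lemma bernoulliField_forall_true (q : unitInterval) (S : Finset V) :
    bernoulliField V q {ω | ∀ s ∈ S, ω s = true} = ENNReal.ofReal q ^ S.card := by
  have h : {ω : V → Bool | ∀ s ∈ S, ω s = true} = Set.pi S fun _ => {true} := by
    ext ω; simp
  rw [h, bernoulliField, Measure.infinitePi_pi _ fun _ _ => measurableSet_singleton _]
  have h1 : bernoulliMeasure true false q {true} = ENNReal.ofReal q := by
    rw [bernoulliMeasure_apply_of_mem_of_notMem q (measurableSet_singleton _) rfl (by simp)]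
    rw [ENNReal.ofReal]
    congr 1
    ext
    simp [q.2.1]
  simp [h1]

lemma isSitePercolation_starField (c : V) (S : Finset V) (x : unitInterval)
    (hx : (x : ℝ) + (x : ℝ) ^ S.card = 1) :
    IsSitePercolation (bernoulliField V x) (starField c S) x := by
  refine ⟨measurable_starField c S, fun v => ?_⟩
  by_cases hv : v = c
  · subst hv
    have h : {ω | starField v S ω v = true} = {ω : V → Bool | ∀ s ∈ S, ω s = true}ᶜ := by
      ext ω
      simp [starField_center]
    have hm : MeasurableSet {ω : V → Bool | ∀ s ∈ S, ω s = true} := by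
      have : {ω : V → Bool | ∀ s ∈ S, ω s = true} = Set.pi S fun _ => {true} := by
        ext ω; simp
      rw [this]
      exact MeasurableSet.pi S.countable_toSet fun _ _ => measurableSet_singleton _
    rw [h, prob_compl_eq_one_sub hm, bernoulliField_forall_true, ← ENNReal.ofReal_pow x.2.1,
      ← ENNReal.ofReal_one, ← ENNReal.ofReal_sub _ (pow_nonneg x.2.1 _)]
    congr 1
    linarith
  · simpa [starField_of_ne hv] using bernoulliField_forall_true x {v}

/-- The two restrictions are functions of disjoint blocks of independent coordinates. -/
lemma indepFun_starField (c : V) (S : Finset V) (x : unitInterval) (U W : Set V)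
    (h : ∀ u ∈ U, ∀ w ∈ W, Disjoint (starSupport c S u) (starSupport c S w)) :
    IndepFun (fun ω (u : U) => starField c S ω u) (fun ω (w : W) => starField c S ω w)
      (bernoulliField V x) := by
  have hi : iIndepFun (fun (v : V) (ω : V → Bool) => ω v) (bernoulliField V x) :=
    iIndepFun_infinitePi (P := fun _ : V => bernoulliMeasure true false x)
      (X := fun _ b => b) fun _ => measurable_id
  have hd : Disjoint (⋃ u ∈ U, starSupport c S u) (⋃ w ∈ W, starSupport c S w) := by
    simp only [Set.disjoint_iUnion_left, Set.disjoint_iUnion_right]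
    exact fun w hw u hu => h u hu w hw
  have hind := indep_iSup_of_disjoint
    (fun v => (measurable_pi_apply (X := fun _ : V => Bool) v).comap_le) hi hd
  have hle : ∀ A : Set V, MeasurableSpace.comap (fun ω (u : A) => starField c S ω u) inferInstance ≤
      ⨆ i ∈ ⋃ u ∈ A, starSupport c S u,
        MeasurableSpace.comap (fun ω : V → Bool => ω i) inferInstance := by
    intro A
    rw [← measurable_iff_comap_le]
    refine @measurable_pi_lambda _ _ _ (_) _ _ fun u => ?_
    refine measurable_starField_apply c S u _ fun v hv => ?_
    rw [measurable_iff_comap_le]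
    exact le_iSup₂_of_le v (Set.mem_biUnion u.2 hv) le_rfl
  exact indep_of_indep_of_le_left (indep_of_indep_of_le_right hind (hle W)) (hle U)

lemma isKIndependent_starField {G : SimpleGraph V} {k : ℕ} (hk : 1 ≤ k) {c : V} {S : Finset V}
    (hS : ∀ s ∈ S, G.Adj c s) (x : unitInterval) :
    IsKIndependent G k (bernoulliField V x) (starField c S) := by
  intro U W hUW
  refine indepFun_starField c S x U W fun u hu w hw => Set.disjoint_left.2 ?_
  have hd := hUW u hu w hw
  -- A common support site forces `u = w`, or one of them is `c` and the other lies in `S`. So their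
  -- distance is at most `1 ≤ k`.
  rintro v (⟨rfl, hv⟩ | ⟨hu', rfl⟩) (⟨rfl, hv'⟩ | ⟨hw', rfl⟩)
  · simp at hd
  · rw [SimpleGraph.dist_eq_one_iff_adj.2 (hS _ hv)] at hd
    omega
  · rw [SimpleGraph.dist_comm, SimpleGraph.dist_eq_one_iff_adj.2 (hS _ hv')] at hd
    omega
  · simp at hd

lemma stochDominates_bernoulliField_zero [Countable V] (μ : Measure (V → Bool))
    [IsProbabilityMeasure μ] : StochDominates μ (bernoulliField V 0) := by
  have hm : Measurable fun z : V → Bool => (z, fun _ : V => false) :=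
    measurable_id.prodMk measurable_const
  refine ⟨μ.map fun z => (z, fun _ => false), ?_, ?_, ?_⟩
  · rw [Measure.map_map measurable_fst hm]
    exact Measure.map_id
  · rw [Measure.map_map measurable_snd hm]
    have : Prod.snd ∘ (fun z : V → Bool => (z, fun _ : V => false)) = fun _ _ => false := rfl
    rw [this, Measure.map_const]
    simp [bernoulliField]
  · have hs : MeasurableSet {x : (V → Bool) × (V → Bool) | x.2 ≤ x.1} := by
      have : {x : (V → Bool) × (V → Bool) | x.2 ≤ x.1} = ⋂ v, {x | x.2 v ≤ x.1 v} := by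
        ext x; simp [Pi.le_def]
      rw [this]
      refine MeasurableSet.iInter fun v => ?_
      have h2 : Measurable fun x : (V → Bool) × (V → Bool) => (x.2 v, x.1 v) := by fun_prop
      exact h2 (Set.toFinite {y : Bool × Bool | y.1 ≤ y.2}).measurableSet
    rw [ae_map_iff hm.aemeasurable hs]
    exact Filter.Eventually.of_forall fun z v => Bool.false_le _

lemma not_stochDominates_starField {c : V} {S : Finset V} (hc : c ∉ S) (P : Measure (V → Bool))
    {q : unitInterval} (hq : q ≠ 0) :
    ¬ StochDominates (P.map (starField c S)) (bernoulliField V q) := by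
  classical
  rintro ⟨π, h1, h2, h3⟩
  set A : Set (V → Bool) := {ω | ∀ s ∈ insert c S, ω s = true} with hA
  have hAm : MeasurableSet A := by
    have : A = Set.pi (insert c S : Finset V) fun _ => {true} := by
      ext ω; simp [hA]
    rw [this]
    exact MeasurableSet.pi (Finset.countable_toSet _) fun _ _ => measurableSet_singleton _
  have hZ : P.map (starField c S) A = 0 := by
    rw [Measure.map_apply (measurable_starField c S) hAm]
    convert measure_empty (μ := P)
    ext ω
    simp only [hA, Set.mem_preimage, Set.mem_ofPred_eq, Set.mem_empty_iff_false, iff_false]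
    intro h
    obtain ⟨s, hs, hs'⟩ := starField_center.1 (h c (Finset.mem_insert_self _ _))
    have := h s (Finset.mem_insert_of_mem hs)
    rw [starField_of_ne (by rintro rfl; exact hc hs), hs'] at this
    exact absurd this (by simp)
  have hB : bernoulliField V q A = 0 := by
    rw [← h2, Measure.map_apply measurable_snd hAm]
    rw [← h1, Measure.map_apply measurable_fst hAm] at hZ
    refine measure_mono_null_ae ?_ hZ
    filter_upwards [h3] with x hx hxA s hs
    -- `A` is increasing, so almost surely the dominating configuration lies in `A` when the
    -- dominated one does.
    exact Bool.eq_true_of_true_le ((hxA s hs).symm.le.trans (hx s))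
  rw [bernoulliField_forall_true] at hB
  have hq0 : (q : ℝ) ≤ 0 := ENNReal.ofReal_eq_zero.1 (pow_eq_zero_iff (by simp) |>.1 hB)
  exact hq (Subtype.ext (le_antisymm hq0 q.2.1))

end Star

/-! ### Spherically symmetric trees -/

/-- Level `n` of the spherically symmetric tree whose vertices on level `i` have `d i` children. -/
def Level (d : ℕ → ℕ) : ℕ → Type
  | 0 => Unit
  | n + 1 => Level d n × Fin (d n)

/-- The vertices of the spherically symmetric tree with offspring sequence `d`. -/
abbrev Vertex (d : ℕ → ℕ) : Type := Σ n, Level d n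

section SphericallySymmetric

variable {d : ℕ → ℕ}

instance Level.fintype : ∀ n, Fintype (Level d n)
  | 0 => inferInstanceAs (Fintype Unit)
  | n + 1 =>
    haveI := Level.fintype n
    inferInstanceAs (Fintype (Level d n × Fin (d n)))

lemma Level.card (n : ℕ) : Fintype.card (Level d n) = ∏ i ∈ Finset.range n, d i := by
  induction n with
  | zero => rfl
  | succ n ih =>
    rw [Finset.prod_range_succ, ← ih]
    exact (Fintype.card_prod (Level d n) (Fin (d n))).trans (by rw [Fintype.card_fin])

/-- The root. -/
def root (d : ℕ → ℕ) : Vertex d := ⟨0, ()⟩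

/-- The `j`-th child of the vertex `v`. -/
def child (v : Vertex d) (j : Fin (d v.1)) : Vertex d := ⟨v.1 + 1, (v.2, j)⟩

@[simp] lemma child_fst (v : Vertex d) (j : Fin (d v.1)) : (child v j).1 = v.1 + 1 := rfl

lemma child_injective (v : Vertex d) : Function.Injective (child v) := by
  intro i j h
  have h' := eq_of_heq (Sigma.mk.inj h).2
  exact (Prod.mk.inj h').2

lemma eq_root_or_child (v : Vertex d) : v = root d ∨ ∃ u j, v = child u j := by
  obtain ⟨n, x⟩ := v
  cases n with
  | zero => exact Or.inl rfl
  | succ n => exact Or.inr ⟨⟨n, x.1⟩, x.2, rfl⟩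

/-- `w` is a child of `v`. -/
def IsChild (v w : Vertex d) : Prop := ∃ j, w = child v j

lemma IsChild.level {v w : Vertex d} (h : IsChild v w) : w.1 = v.1 + 1 := by
  obtain ⟨j, rfl⟩ := h
  rfl

lemma IsChild.parent_unique {u v w : Vertex d} (hu : IsChild u w) (hv : IsChild v w) : u = v := by
  obtain ⟨i, rfl⟩ := hu
  obtain ⟨j, h⟩ := hv
  obtain ⟨n, x⟩ := u
  obtain ⟨m, y⟩ := v
  obtain rfl : n = m := Nat.succ.inj (Sigma.mk.inj h).1
  have h' := eq_of_heq (Sigma.mk.inj h).2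
  rw [show x = y from (Prod.mk.inj h').1]

/-- The spherically symmetric tree with offspring sequence `d`. -/
def symTree (d : ℕ → ℕ) : SimpleGraph (Vertex d) where
  Adj v w := IsChild v w ∨ IsChild w v
  symm := ⟨fun _ _ h => h.symm⟩
  loopless := ⟨fun v h => by
    rcases h with h | h <;> exact absurd h.level (by omega)⟩

lemma symTree_reachable_root (v : Vertex d) : (symTree d).Reachable (root d) v := by
  induction h : v.1 generalizing v with
  | zero =>
    rcases eq_root_or_child v with rfl | ⟨u, j, rfl⟩
    · rfl
    · simp at h
  | succ n ih =>
    rcases eq_root_or_child v with rfl | ⟨u, j, rfl⟩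
    · rfl
    · have hadj : (symTree d).Adj u (child u j) := Or.inl ⟨j, rfl⟩
      exact (ih u (by simpa using h)).trans hadj.reachable

lemma symTree_connected : (symTree d).Connected where
  preconnected u v := (symTree_reachable_root u).symm.trans (symTree_reachable_root v)
  nonempty := ⟨root d⟩

/-- On a cycle, both neighbours of a vertex of maximal level would be its parent, but they are
distinct. -/
lemma symTree_isAcyclic : (symTree d).IsAcyclic := by
  classical
  intro v p hp
  obtain ⟨u, hu, hmax⟩ := p.support.toFinset.exists_max_image Sigma.fst
    ⟨v, by simp⟩
  rw [List.mem_toFinset] at hu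
  have hr := hp.rotate hu
  have hpar : ∀ w ∈ (p.rotate u hu).support, (symTree d).Adj u w → IsChild w u := by
    rintro w hw (h | h)
    · have := hmax w (by
        rw [List.mem_toFinset]
        simpa using hw)
      have := h.level
      omega
    · exact h
  refine hr.snd_ne_penultimate (IsChild.parent_unique (w := u) ?_ ?_)
  · exact hpar _ (SimpleGraph.Walk.getVert_mem_support _ _)
      (SimpleGraph.Walk.adj_snd hr.not_nil)
  · exact hpar _ (SimpleGraph.Walk.getVert_mem_support _ _)
      (SimpleGraph.Walk.adj_penultimate hr.not_nil).symm

lemma symTree_isTree : (symTree d).IsTree := ⟨symTree_connected, symTree_isAcyclic⟩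

lemma symTree_level_le_of_adj {u v : Vertex d} (h : (symTree d).Adj u v) : v.1 ≤ u.1 + 1 := by
  rcases h with h | h <;> have := h.level <;> omega

lemma symTree_level_le (u v : Vertex d) : v.1 ≤ u.1 + (symTree d).dist u v := by
  obtain ⟨p, hp⟩ := symTree_connected.exists_walk_length_eq_dist u v
  rw [← hp]
  clear hp
  induction p with
  | nil => simp
  | cons h p ih =>
    have := symTree_level_le_of_adj h
    rw [SimpleGraph.Walk.length_cons]
    omega

/-- The vertices of level at most `n`. -/
def levelsUpTo (d : ℕ → ℕ) (n : ℕ) : Finset (Vertex d) :=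
  (Finset.range (n + 1)).sigma fun _ => Finset.univ

lemma mem_levelsUpTo {n : ℕ} {v : Vertex d} : v ∈ levelsUpTo d n ↔ v.1 ≤ n := by
  simp [levelsUpTo]

lemma card_levelsUpTo (n : ℕ) :
    (levelsUpTo d n).card = ∑ j ∈ Finset.range (n + 1), ∏ i ∈ Finset.range j, d i := by
  simp [levelsUpTo, Finset.card_sigma, Level.card]

lemma symTree_neighborSet_finite (v : Vertex d) : ((symTree d).neighborSet v).Finite :=
  (levelsUpTo d (v.1 + 1)).finite_toSet.subset fun _ hw =>
    mem_levelsUpTo.2 (symTree_level_le_of_adj hw)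

lemma sphere_subset (o : Vertex d) (n : ℕ) :
    {v | (symTree d).dist o v = n} ⊆ (levelsUpTo d (o.1 + n) : Set (Vertex d)) := by
  rintro v rfl
  exact mem_levelsUpTo.2 (symTree_level_le o v)

lemma sphere_finite (o : Vertex d) (n : ℕ) : {v | (symTree d).dist o v = n}.Finite :=
  (levelsUpTo d (o.1 + n)).finite_toSet.subset (sphere_subset o n)

/-! ### Branching number of spherically symmetric trees -/

/-- `v` is a descendant of `o`. -/
abbrev IsDescendant (o v : Vertex d) : Prop := Relation.ReflTransGen IsChild o v

lemma IsDescendant.dist_add {o v : Vertex d} (h : IsDescendant o v) :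
    (symTree d).dist o v + o.1 = v.1 := by
  refine le_antisymm ?_ (by have := symTree_level_le o v; omega)
  induction h with
  | refl => simp
  | @tail u w _ hw ih =>
    have h1 := symTree_connected.dist_triangle (u := o) (v := u) (w := w)
    have h2 : (symTree d).dist u w = 1 := SimpleGraph.dist_eq_one_iff_adj.2 (Or.inl hw)
    have := hw.level
    omega

lemma IsDescendant.of_child {o v w : Vertex d} (h : IsDescendant o w) (hw : IsChild v w)
    (hne : w ≠ o) : IsDescendant o v := by
  rcases Relation.ReflTransGen.cases_tail h with rfl | ⟨u, hu, huw⟩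
  · exact absurd rfl hne
  · rwa [hw.parent_unique huw]

open Classical in
/-- The flow from `o` that splits evenly at every descendant of `o`. -/
noncomputable def evenFlow (o v : Vertex d) : ℝ :=
  if IsDescendant o v then ((∏ i ∈ Finset.range v.1, d i : ℕ) : ℝ)⁻¹ else 0

lemma evenFlow_hasSum (hd : ∀ n, d n ≠ 0) (o v : Vertex d) :
    HasSum (fun w : children (symTree d) o v => evenFlow o w) (evenFlow o v) := by
  change HasSum (evenFlow o ∘ ((↑) : children (symTree d) o v → Vertex d)) _
  rw [hasSum_subtype_iff_indicator]
  by_cases hv : IsDescendant o v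
  · have hchild : ∀ j, IsDescendant o (child v j) := fun j => hv.tail ⟨j, rfl⟩
    rw [← (child_injective v).hasSum_iff]
    · have hval : ∀ j, (Set.indicator (children (symTree d) o v) (evenFlow o) ∘ child v) j =
          ((∏ i ∈ Finset.range v.1, d i : ℕ) : ℝ)⁻¹ * (d v.1 : ℝ)⁻¹ := by
        intro j
        have hmem : child v j ∈ children (symTree d) o v := by
          refine ⟨Or.inl ⟨j, rfl⟩, ?_⟩
          have h1 := hv.dist_add
          have h2 := IsDescendant.dist_add (hchild j)
          rw [child_fst] at h2
          omega
        rw [Function.comp_apply, Set.indicator_of_mem hmem, evenFlow, if_pos (hchild j), child_fst,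
          Finset.prod_range_succ, Nat.cast_mul, mul_inv]
      convert hasSum_fintype
        (Set.indicator (children (symTree d) o v) (evenFlow o) ∘ child v) using 1
      simp only [hval, Finset.sum_const, Finset.card_univ, Fintype.card_fin, nsmul_eq_mul]
      have : (d v.1 : ℝ) ≠ 0 := Nat.cast_ne_zero.2 (hd _)
      rw [evenFlow, if_pos hv]
      field_simp
    · intro w hw
      -- The only other neighbour of `v` is its parent, which, if a descendant of `o`, is closer to
      -- `o` than `v`.
      refine Set.indicator_apply_eq_zero.2 fun hwc => if_neg fun hwd => ?_
      rcases hwc.1 with ⟨j, rfl⟩ | h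
      · exact hw ⟨j, rfl⟩
      · have h1 := hv.dist_add
        have h2 := IsDescendant.dist_add hwd
        have h3 := h.level
        have h4 := hwc.2
        omega
  · have h0 : Set.indicator (children (symTree d) o v) (evenFlow o) = 0 := by
      ext w
      refine Set.indicator_apply_eq_zero.2 fun hwc => if_neg fun hwd => hv ?_
      rcases hwc.1 with h | h
      · refine IsDescendant.of_child hwd h ?_
        rintro rfl
        simpa using hwc.2
      · exact hwd.tail h
    rw [h0, evenFlow, if_neg hv]
    exact hasSum_zero

variable {b C : ℝ}

lemma isFlow_evenFlow (hb : 1 ≤ b) (hd : ∀ n, d n ≠ 0)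
    (hlow : ∀ n, b ^ n ≤ (∏ i ∈ Finset.range n, d i : ℕ)) (o : Vertex d) :
    IsFlow (symTree d) o b (evenFlow o) := by
  intro v
  have hb0 : 0 < b := by linarith
  refine ⟨?_, evenFlow_hasSum hd o v, ?_⟩
  · rw [evenFlow]
    split_ifs <;> positivity
  · rw [evenFlow]
    split_ifs with h
    · refine inv_anti₀ (by positivity) ?_
      refine le_trans (pow_le_pow_right₀ hb ?_) (hlow v.1)
      have := IsDescendant.dist_add h
      omega
    · positivity

lemma evenFlow_ne_zero (hd : ∀ n, d n ≠ 0) (o : Vertex d) : evenFlow o ≠ 0 := by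
  intro h
  have h' := congrFun h o
  rw [evenFlow, if_pos Relation.ReflTransGen.refl, Pi.zero_apply, inv_eq_zero, Nat.cast_eq_zero,
    Finset.prod_eq_zero_iff] at h'
  obtain ⟨i, _, hi⟩ := h'
  exact hd i hi

lemma card_levelsUpTo_le (hb : 1 ≤ b) (hC : 0 ≤ C)
    (hup : ∀ n : ℕ, ((∏ i ∈ Finset.range n, d i : ℕ) : ℝ) ≤ C * (n + 1) * b ^ n) (n : ℕ) :
    ((levelsUpTo d n).card : ℝ) ≤ C * ((n + 1 : ℕ) : ℝ) ^ 2 * b ^ n := by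
  rw [card_levelsUpTo, Nat.cast_sum]
  calc ∑ j ∈ Finset.range (n + 1), ((∏ i ∈ Finset.range j, d i : ℕ) : ℝ)
      ≤ ∑ _j ∈ Finset.range (n + 1), C * (n + 1) * b ^ n := by
        refine Finset.sum_le_sum fun j hj => (hup j).trans ?_
        have hj' : j ≤ n := Nat.lt_succ_iff.1 (Finset.mem_range.1 hj)
        have : (j : ℝ) ≤ n := Nat.cast_le.2 hj'
        gcongr
    _ = C * ((n + 1 : ℕ) : ℝ) ^ 2 * b ^ n := by
        rw [Finset.sum_const, Finset.card_range, nsmul_eq_mul]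
        push_cast
        ring

/-- The sphere of radius `n` has at most a quadratic polynomial in `n` times `b ^ n` vertices, each
carrying at most `lam ^ (-n)`. So the flow at the root vanishes, and with it every other value. -/
lemma isFlow_eq_zero {lam : ℝ} (hb : 1 ≤ b) (hlam : b < lam) (hC : 0 ≤ C)
    (hup : ∀ n : ℕ, ((∏ i ∈ Finset.range n, d i : ℕ) : ℝ) ≤ C * (n + 1) * b ^ n)
    {o : Vertex d} {f : Vertex d → ℝ} (hf : IsFlow (symTree d) o lam f) : f = 0 := by
  have hb0 : 0 < b := by linarith
  have hlam0 : 0 < lam := by linarith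
  -- The prefactor lets the bound be a shift by `o.1 + 1` of the null sequence `n ^ 2 * (b / lam) ^
  -- n`.
  have hbound : ∀ n : ℕ, f o ≤
      C * lam ^ (o.1 + 1) * b⁻¹ * (((n + (o.1 + 1) : ℕ) : ℝ) ^ 2 * (b / lam) ^ (n + (o.1 + 1))) := by
    intro n
    have hcard : ((sphere_finite o n).toFinset.card : ℝ) ≤ (levelsUpTo d (o.1 + n)).card := by
      refine Nat.cast_le.2 (Finset.card_le_card fun v hv => ?_)
      exact sphere_subset o n ((sphere_finite o n).mem_toFinset.1 hv)
    calc f o ≤ (sphere_finite o n).toFinset.card * (lam ^ n)⁻¹ :=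
          hf.root_le_card_sphere symTree_isTree (sphere_finite o) n
      _ ≤ (C * ((o.1 + n + 1 : ℕ) : ℝ) ^ 2 * b ^ (o.1 + n)) * (lam ^ n)⁻¹ := by
          refine mul_le_mul_of_nonneg_right (hcard.trans ?_) (by positivity)
          exact card_levelsUpTo_le hb hC hup _
      _ = _ := by
          rw [show o.1 + n + 1 = n + (o.1 + 1) by ring, div_pow, pow_add lam n,
            show b ^ (n + (o.1 + 1)) = b ^ (o.1 + n) * b by rw [← pow_succ]; congr 1; ring]
          field_simp
  have hlim : Filter.Tendsto (fun n : ℕ => C * lam ^ (o.1 + 1) * b⁻¹ *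
      (((n + (o.1 + 1) : ℕ) : ℝ) ^ 2 * (b / lam) ^ (n + (o.1 + 1)))) Filter.atTop (nhds 0) := by
    have h := tendsto_pow_const_mul_const_pow_of_lt_one 2 (r := b / lam) (by positivity)
      ((div_lt_one hlam0).2 hlam)
    have h' := ((Filter.tendsto_add_atTop_iff_nat (o.1 + 1)).2 h).const_mul
      (C * lam ^ (o.1 + 1) * b⁻¹)
    simpa using h'
  have h0 : f o ≤ 0 := ge_of_tendsto' hlim hbound
  ext v
  exact le_antisymm ((hf.le_root symTree_connected v).trans h0) (hf v).1

lemma isBranchingNumber_symTree (hb : 1 ≤ b) (hC : 0 ≤ C) (hd : ∀ n, d n ≠ 0)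
    (hlow : ∀ n, b ^ n ≤ (∏ i ∈ Finset.range n, d i : ℕ))
    (hup : ∀ n : ℕ, ((∏ i ∈ Finset.range n, d i : ℕ) : ℝ) ≤ C * (n + 1) * b ^ n) (o : Vertex d) :
    IsBranchingNumber (symTree d) o b := by
  refine IsGreatest.isLUB ⟨⟨hb, evenFlow o, evenFlow_ne_zero hd o, isFlow_evenFlow hb hd hlow o⟩, ?_⟩
  rintro lam ⟨-, f, hf0, hf⟩
  by_contra! h
  exact hf0 (isFlow_eq_zero hb h hC hup hf)

lemma infinite_vertex (hd : ∀ n, d n ≠ 0) : Infinite (Vertex d) := by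
  have hne : ∀ n, Nonempty (Level d n) := by
    intro n
    rw [← Fintype.card_pos_iff, Level.card]
    exact Finset.prod_pos fun i _ => Nat.pos_of_ne_zero (hd i)
  exact Infinite.of_injective (fun n : ℕ => (⟨n, (hne n).some⟩ : Vertex d))
    fun _ _ h => congrArg Sigma.fst h

/-- The children of the root. -/
def rootChildren (d : ℕ → ℕ) : Finset (Vertex d) :=
  Finset.univ.map ⟨child (root d), child_injective (root d)⟩

lemma card_rootChildren : (rootChildren d).card = d 0 := by
  rw [rootChildren, Finset.card_map, Finset.card_univ, Fintype.card_fin]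
  rfl

lemma root_adj_of_mem_rootChildren {v : Vertex d} (h : v ∈ rootChildren d) :
    (symTree d).Adj (root d) v := by
  obtain ⟨j, -, rfl⟩ := Finset.mem_map.1 h
  exact Or.inl ⟨j, rfl⟩

end SphericallySymmetric

/-! ### Choice of the offspring sequence and of the parameter -/

/-- The level sizes of a spherically symmetric tree of growth `b` whose root has `m` children. -/
noncomputable def levelSize (b : ℝ) (m : ℕ) : ℕ → ℕ
  | 0 => 1
  | 1 => m
  | n + 2 => levelSize b m (n + 1) * ⌈b ^ (n + 2) / levelSize b m (n + 1)⌉₊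

/-- The offspring sequence of a spherically symmetric tree of growth `b` whose root has `m`
children. -/
noncomputable def offspring (b : ℝ) (m : ℕ) : ℕ → ℕ
  | 0 => m
  | n + 1 => ⌈b ^ (n + 2) / levelSize b m (n + 1)⌉₊

lemma prod_offspring (b : ℝ) (m n : ℕ) :
    ∏ i ∈ Finset.range n, offspring b m i = levelSize b m n := by
  induction n with
  | zero => rfl
  | succ n ih =>
    rw [Finset.prod_range_succ, ih]
    cases n with
    | zero => simp [offspring, levelSize]
    | succ n => rfl

/-- Rounding up keeps each level at least `b ^ n` and adds at most the size of the previous level.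
These errors accumulate to the linear factor `n + 1`. -/
lemma levelSize_bounds {b : ℝ} (hb : 1 ≤ b) {m : ℕ} (hm : b ≤ m) (n : ℕ) :
    b ^ n ≤ levelSize b m n ∧ (levelSize b m n : ℝ) ≤ m * (n + 1) * b ^ n := by
  have hb0 : 0 < b := by linarith
  have hm1 : (1 : ℝ) ≤ m := hb.trans hm
  induction n with
  | zero => simpa [levelSize] using hm1
  | succ n ih =>
    cases n with
    | zero =>
      refine ⟨by simpa [levelSize] using hm, ?_⟩
      simp only [levelSize, Nat.cast_add, Nat.cast_zero, Nat.cast_one]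
      norm_num
      nlinarith
    | succ n =>
      set N : ℝ := (levelSize b m (n + 1) : ℝ) with hN
      have hN0 : 0 < N := lt_of_lt_of_le (by positivity) ih.1
      have hval : (levelSize b m (n + 1 + 1) : ℝ) = N * ⌈b ^ (n + 2) / N⌉₊ := by
        simp [levelSize, hN]
      rw [hval]
      constructor
      · calc b ^ (n + 2) = N * (b ^ (n + 2) / N) := by field_simp
          _ ≤ N * ⌈b ^ (n + 2) / N⌉₊ := by
            gcongr
            exact Nat.le_ceil _
      · have h1 : N * ⌈b ^ (n + 2) / N⌉₊ ≤ b ^ (n + 2) + N := by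
          calc N * ⌈b ^ (n + 2) / N⌉₊ ≤ N * (b ^ (n + 2) / N + 1) := by
                gcongr
                exact (Nat.ceil_lt_add_one (by positivity)).le
            _ = b ^ (n + 2) + N := by field_simp
        have h2 : b ^ (n + 1) ≤ b ^ (n + 2) := pow_le_pow_right₀ hb (by omega)
        have h3 : N ≤ m * ((n + 1 : ℕ) + 1) * b ^ (n + 2) := ih.2.trans (by gcongr)
        have h4 : b ^ (n + 2) ≤ m * b ^ (n + 2) := le_mul_of_one_le_left (by positivity) hm1
        push_cast at h3 ⊢
        have : n + 1 + 1 = n + 2 := rfl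
        rw [this]
        linarith

lemma offspring_ne_zero {b : ℝ} (hb : 1 ≤ b) {m : ℕ} (hm : b ≤ m) (n : ℕ) :
    offspring b m n ≠ 0 := by
  have hb0 : 0 < b := by linarith
  intro h
  have h1 := (levelSize_bounds hb hm (n + 1)).1
  rw [← prod_offspring, Finset.prod_range_succ, h, mul_zero, Nat.cast_zero] at h1
  exact absurd h1 (not_le.2 (by positivity))

/-- Intermediate value theorem on `[p, 1]`: `x + x ^ m` is at most `1` at `p` and exceeds `1` at
`1`. -/
lemma exists_add_pow_eq_one {p : ℝ} (hp1 : p < 1) {m : ℕ}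
    (hm : p ^ m ≤ 1 - p) : ∃ x, p ≤ x ∧ x < 1 ∧ x + x ^ m = 1 := by
  obtain ⟨x, hx, hx'⟩ := intermediate_value_Icc (f := fun x : ℝ => x + x ^ m) hp1.le
    (by fun_prop) (show (1 : ℝ) ∈ _ from ⟨by linarith, by simp⟩)
  refine ⟨x, hx.1, lt_of_le_of_ne hx.2 ?_, hx'⟩
  rintro rfl
  simp at hx'

end TreePercolation

theorem mainTheorem8 (k : ℕ) (hk : 1 ≤ k) (p : ℝ) (hp0 : 0 ≤ p) (hp1 : p < 1)
    (b : ℝ) (hb : 1 ≤ b) :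
    ∃ p' : ℝ, p ≤ p' ∧ p' < 1 ∧
      ∃ (V : Type) (G : SimpleGraph V),
        G.IsTree ∧ Infinite V ∧ (∀ v, (G.neighborSet v).Finite) ∧
        (∀ o, TreePercolation.IsBranchingNumber G o b) ∧
        ∃ (Ω : Type) (_ : MeasurableSpace Ω) (P : Measure Ω) (_ : IsProbabilityMeasure P)
          (Z : Ω → V → Bool),
          TreePercolation.IsSitePercolation P Z p' ∧
          TreePercolation.IsKIndependent G k P Z ∧
          ∀ q : unitInterval,
            TreePercolation.StochDominates (P.map Z) (TreePercolation.bernoulliField V q) ↔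
              q = 0 := by
  open TreePercolation in
  -- The root gets `m` children: `b ≤ m` makes the first level large enough, and `p ^ m ≤ 1 - p`
  -- allows a parameter `x ≥ p`.
  obtain ⟨m, hmb, hmp⟩ : ∃ m : ℕ, b ≤ m ∧ p ^ m ≤ 1 - p := by
    have h1 := (tendsto_natCast_atTop_atTop (R := ℝ)).eventually_ge_atTop b
    have h2 := (tendsto_pow_atTop_nhds_zero_of_lt_one hp0 hp1).eventually_le_const
      (show (0 : ℝ) < 1 - p by linarith)
    exact (h1.and h2).exists
  obtain ⟨x, hpx, hx1, hx⟩ := exists_add_pow_eq_one hp1 hmp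
  have hd := offspring_ne_zero hb hmb
  let x' : unitInterval := ⟨x, hp0.trans hpx, hx1.le⟩
  let d := offspring b m
  have hbr : ∀ o, IsBranchingNumber (symTree d) o b :=
    isBranchingNumber_symTree hb (C := m) (Nat.cast_nonneg m) hd
      (fun n => by rw [prod_offspring]; exact (levelSize_bounds hb hmb n).1)
      (fun n => by rw [prod_offspring]; exact (levelSize_bounds hb hmb n).2)
  have hZ := measurable_starField (root d) (rootChildren d)
  refine ⟨x, hpx, hx1, Vertex d, symTree d, symTree_isTree, infinite_vertex hd,
    symTree_neighborSet_finite, hbr, Vertex d → Bool, inferInstance, bernoulliField _ x',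
    inferInstance, starField (root d) (rootChildren d), ?_, ?_, fun q => ⟨fun h => ?_, ?_⟩⟩
  · exact isSitePercolation_starField _ _ x' (by rw [card_rootChildren]; exact hx)
  · exact isKIndependent_starField hk (fun s hs => root_adj_of_mem_rootChildren hs) x'
  · by_contra hq
    refine not_stochDominates_starField (fun hc => ?_) _ hq h
    exact (root_adj_of_mem_rootChildren hc).ne rfl
  · rintro rfl
    have := Measure.isProbabilityMeasure_map (μ := bernoulliField (Vertex d) x') hZ.aemeasurable
    exact stochDominates_bernoulliField_zero _
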